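/- Consider the planar autoregressive equation \[ X_{i,j} = a X_{i-1,j} + b X_{i,j-1} + c X_{i-1,j-1} + \epsilon_{i,j}, \qquad i,j\in\mathbb Z, \] where the $\epsilon_{i,j}$ are uncorrelated real random variables with zero mean and common variance $\sigma_\epsilon^2$, and let \[ \Theta = \{(a,b,c,v)\in\mathbb R^4 : (1-a-b-c)(1-a+b+c)(1+a-b+c)(1+a+b-c)>0,\ v>0\}. \] For each $\theta=(a,b,c,\sigma_\epsilon^2)\in\Theta$, wide-sense stationary solutions $X$ exist (on a suitable probability space), and all of them have the same autocovariance function $\gamma_X(h_1,h_2)=\operatorname{cov}(X_{i,j},X_{i-h_1,j-h_2})$. Having the same autocovariance function is therefore an equivalence relation on $\Theta$, and it splits $\Theta$ into the following classes. Let $(a,b,c,\sigma_\epsilon^2)\in\Theta$. \begin{enumerate} \item If $c\neq -ab$ and $c\neq 0$, the class of $(a,b,c,\sigma_\epsilon^2)$ has exactly two elements: $(a,b,c,\sigma_\epsilon^2)$ and $(-b/c,\,-a/c,\,1/c,\,c^{-2}\sigma_\epsilon^2)$. \item If $c=-ab\neq 0$, the class has exactly four elements: $(a,\,b,\,-ab,\,\sigma_\epsilon^2)$,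 $(a^{-1},\,b^{-1},\,-a^{-1}b^{-1},\,a^{-2}b^{-2}\sigma_\epsilon^2)$, $(a^{-1},\,b,\,-a^{-1}b,\,a^{-2}\sigma_\epsilon^2)$ and $(a,\,b^{-1},\,-ab^{-1},\,b^{-2}\sigma_\epsilon^2)$. \item If $a\neq0$ and $b=c=0$, the class has exactly two elements: $(a,0,0,\sigma_\epsilon^2)$ and $(a^{-1},0,0,a^{-2}\sigma_\epsilon^2)$. If $b\ne0$ and $a=c=0$, the class has exactly two elements: $(0,b,0,\sigma_\epsilon^2)$ and $(0,b^{-1},0,b^{-2}\sigma_\epsilon^2)$. \item If $c=0$ and $ab\neq0$, or if $a=b=c=0$, the class consists of $(a,b,c,\sigma_\epsilon^2)$ alone. \end{enumerate} -/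

import Mathlib

open MeasureTheory ProbabilityTheory

namespace PlanarAR

/-- A parameter `(a, b, c, v)`: three real coefficients and the error variance `v`. -/
abbrev Parameter : Type := ℝ × ℝ × ℝ × ℝ

/-- The parameter set `Θ`. -/
def Theta : Set Parameter :=
  {θ | match θ with
    | (a, b, c, v) =>
      0 < (1 - a - b - c) * (1 - a + b + c) * (1 + a - b + c) * (1 + a + b - c) ∧ 0 < v}

section Fields

variable {Ω : Type*} [MeasurableSpace Ω]

/-- A collection of uncorrelated, zero-mean, square-integrable real random variables
indexed by `ℤ × ℤ`, all of variance `v`. -/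
structure IsWhiteNoise (μ : Measure Ω) (v : ℝ) (ε : ℤ → ℤ → Ω → ℝ) : Prop where
  memLp : ∀ i j, MemLp (ε i j) 2 μ
  mean_zero : ∀ i j, ∫ ω, ε i j ω ∂μ = 0
  variance_eq : ∀ i j, variance (ε i j) μ = v
  uncorrelated : ∀ i j k l, (i, j) ≠ (k, l) → covariance (ε i j) (ε k l) μ = 0

/-- `X` is a wide-sense stationary real random field with autocovariance function `γ`, where
`γ h₁ h₂` is the covariance of `X i j` and `X (i - h₁) (j - h₂)` for every `i`, `j`. -/
structure IsStationaryWithAutocovariance (μ : Measure Ω) (X : ℤ → ℤ → Ω → ℝ)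
    (γ : ℤ → ℤ → ℝ) : Prop where
  memLp : ∀ i j, MemLp (X i j) 2 μ
  mean_const : ∃ m : ℝ, ∀ i j, ∫ ω, X i j ω ∂μ = m
  covariance_eq : ∀ h₁ h₂ i j, covariance (X i j) (X (i - h₁) (j - h₂)) μ = γ h₁ h₂

/-- The first-order planar autoregressive equation with error field `ε`. -/
def SatisfiesAR (μ : Measure Ω) (a b c : ℝ) (ε X : ℤ → ℤ → Ω → ℝ) : Prop :=
  ∀ i j, ∀ᵐ ω ∂μ,
    X i j ω = a * X (i - 1) j ω + b * X i (j - 1) ω + c * X (i - 1) (j - 1) ω + ε i j ω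

end Fields

/-- `γ` is the autocovariance function of some wide-sense stationary solution `X` of the
autoregressive equation with parameter `(a, b, c, v)`. -/
def IsAutocovarianceOf (θ : Parameter) (γ : ℤ → ℤ → ℝ) : Prop :=
  match θ with
  | (a, b, c, v) =>
    ∃ (Ω : Type) (_ : MeasurableSpace Ω) (μ : Measure Ω) (ε X : ℤ → ℤ → Ω → ℝ),
      IsProbabilityMeasure μ ∧ IsWhiteNoise μ v ε ∧
      IsStationaryWithAutocovariance μ X γ ∧ SatisfiesAR μ a b c ε X

/-- Two parameters define the same autocovariance function. -/
def SameAutocovariance (θ θ' : Parameter) : Prop :=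
  ∃ γ, IsAutocovarianceOf θ γ ∧ IsAutocovarianceOf θ' γ

/-- All parameters in `Θ` that define the same autocovariance function as `θ`. -/
def autocovarianceClass (θ : Parameter) : Set Parameter :=
  {θ' | θ' ∈ Theta ∧ SameAutocovariance θ θ'}

end PlanarAR

namespace PlanarAR

/-! Let P(z,w) = 1 - az - bw - czw. For |z| = 1, |1 - az|² - |b + cz|² = (1 + a² - b² - c²) - 2(a +
bc) Re z, so the inequality on the coefficients in Θ says exactly that P has no zero with |z| = |w|
= 1. The spectral density of a stationary solution is then proportional to v/|P|², and two
parameters share an autocovariance function iff v⁻¹|P|² agrees on the torus, which amounts to five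
equations between Fourier coefficients (`SameSpectrum`).

Spectral representations are avoided. An autocovariance function is bounded and solves the
Yule–Walker equation `lead (lag γ) = unitMass v`; a weighted energy estimate makes bounded solutions
unique (`eq_of_lead_lag_eq`), and an explicit random field on a torus gives existence
(`exists_isAutocovarianceOf`). Commuting the operators of two parameters turns equality of
autocovariances into `SameSpectrum`.

The rest is algebra. Two moves preserve |P| up to a constant: replacing P by zw P(1/z,1/w), and,
when c = -ab and P = (1 - az)(1 - bw), reflecting a single factor. `spectrum_cases` shows that for c
≠ 0 there are no others; for c = 0 the equations collapse to conditions on r = v'/v. -/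

theorem mem_Theta_iff {a b c v : ℝ} : (a, b, c, v) ∈ Theta ↔
    4 * (a + b * c) ^ 2 < (1 + a ^ 2 - b ^ 2 - c ^ 2) ^ 2 ∧ 0 < v := by
  have h : (1 - a - b - c) * (1 - a + b + c) * (1 + a - b + c) * (1 + a + b - c)
      = (1 + a ^ 2 - b ^ 2 - c ^ 2) ^ 2 - 4 * (a + b * c) ^ 2 := by ring
  change 0 < (1 - a - b - c) * (1 - a + b + c) * (1 + a - b + c) * (1 + a + b - c) ∧ 0 < v ↔ _
  rw [h, sub_pos]

/-! ### Uniqueness of bounded solutions by weighted energy -/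

/-- The lag operator `1 - a B₁ - b B₂ - c B₁ B₂` on functions on `ℤ × ℤ`. -/
def lag (a b c : ℝ) (g : ℤ → ℤ → ℝ) : ℤ → ℤ → ℝ := fun i j =>
  g i j - a * g (i - 1) j - b * g i (j - 1) - c * g (i - 1) (j - 1)

/-- The adjoint of `lag`, built from forward shifts. -/
def lead (a b c : ℝ) (g : ℤ → ℤ → ℝ) : ℤ → ℤ → ℝ := fun i j =>
  g i j - a * g (i + 1) j - b * g i (j + 1) - c * g (i + 1) (j + 1)

/-- The energy estimate behind uniqueness: a slowly varying summable weight `w` and a bounded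
solution `g` of the homogeneous equation. -/
theorem energy_estimate {a b c δ M : ℝ} {w g : ℤ × ℤ → ℝ} (hδ : 0 ≤ δ) (hδ1 : δ ≤ 1)
    (hw : ∀ p, 0 < w p) (hws : Summable w)
    (hw1 : ∀ p, |w (p + (1, 0)) - w p| ≤ δ * w p)
    (hw2 : ∀ p, |w (p + (0, 1)) - w p| ≤ δ * w p)
    (hg : ∀ p, |g p| ≤ M)
    (h : ∀ p, g p - a * g (p - (1, 0)) =
      b * g (p - (0, 1)) + c * g (p - (0, 1) - (1, 0))) :
    |1 + a ^ 2 - b ^ 2 - c ^ 2| * ∑' p, w p * g p ^ 2 ≤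
      (2 * |a + b * c| + δ * (|a + b * c| + 4 * (b ^ 2 + c ^ 2) + (a ^ 2 + c ^ 2))) *
        ∑' p, w p * g p ^ 2 := by
  have hM : 0 ≤ M := (abs_nonneg _).trans (hg 0)
  have key : ∀ f : ℤ × ℤ → ℝ, (∃ K, ∀ p, |f p| ≤ K) → Summable fun p => w p * f p := by
    rintro f ⟨K, hK⟩
    refine Summable.of_norm_bounded (hws.mul_right K) fun p => ?_
    rw [Real.norm_eq_abs, abs_mul, abs_of_pos (hw p)]
    exact mul_le_mul_of_nonneg_left (hK p) (hw p).le
  have hprod : ∀ p q, |g p * g q| ≤ M * M := fun p q => by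
    rw [abs_mul]; exact mul_le_mul (hg p) (hg q) (abs_nonneg _) hM
  have hsq : ∀ p, |g p ^ 2| ≤ M * M := fun p => by rw [pow_two]; exact hprod p p
  have sA : Summable fun p => w p * g p ^ 2 := key _ ⟨_, hsq⟩
  have sA' : Summable fun p => w p * g (p - (1, 0)) ^ 2 := key _ ⟨_, fun p => hsq _⟩
  have sC : Summable fun p => w p * (g p * g (p - (1, 0))) := key _ ⟨_, fun p => hprod _ _⟩
  -- shifting the summation variable against the slowly varying weight
  have shift : ∀ (e : ℤ × ℤ) (f : ℤ × ℤ → ℝ), (∀ p, |w (p + e) - w p| ≤ δ * w p) →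
      (∀ p, 0 ≤ f p) → Summable (fun p => w p * f p) → Summable (fun p => w p * f (p - e)) →
      |∑' p, w p * f (p - e) - ∑' p, w p * f p| ≤ δ * ∑' p, w p * f p := by
    intro e f hwe hf s1 s2
    have e1 : ∑' p, w p * f (p - e) = ∑' p, w (p + e) * f p := by
      rw [← (Equiv.addRight e).tsum_eq]; simp
    have s3 : Summable fun p => w (p + e) * f p := by
      have := (Equiv.addRight e).summable_iff.2 s2
      simpa [Function.comp_def] using this
    rw [e1, ← s3.tsum_sub s1, ← tsum_mul_left]
    have hb : ∀ p, ‖w (p + e) * f p - w p * f p‖ ≤ δ * (w p * f p) := fun p => by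
      rw [← sub_mul, Real.norm_eq_abs, abs_mul, abs_of_nonneg (hf p), ← mul_assoc]
      exact mul_le_mul_of_nonneg_right (hwe p) (hf p)
    exact tsum_of_norm_bounded (s1.mul_left δ).hasSum hb
  set A := ∑' p, w p * g p ^ 2 with hA
  set A' := ∑' p, w p * g (p - (1, 0)) ^ 2 with hA'
  set C := ∑' p, w p * (g p * g (p - (1, 0))) with hC
  have hA0 : 0 ≤ A := tsum_nonneg fun p => mul_nonneg (hw p).le (sq_nonneg _)
  have hA'A : |A' - A| ≤ δ * A :=
    shift (1, 0) (fun p => g p ^ 2) hw1 (fun p => sq_nonneg _) sA sA'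
  have quad : ∀ x y : ℝ, HasSum (fun p => w p * (x * g p + y * g (p - (1, 0))) ^ 2)
      (x ^ 2 * A + y ^ 2 * A' + 2 * x * y * C) := fun x y => by
    have e : (fun p => w p * (x * g p + y * g (p - (1, 0))) ^ 2) = fun p =>
        x ^ 2 * (w p * g p ^ 2) + y ^ 2 * (w p * g (p - (1, 0)) ^ 2) +
          2 * x * y * (w p * (g p * g (p - (1, 0)))) := funext fun p => by ring
    rw [e]
    exact ((sA.hasSum.mul_left (x ^ 2)).add (sA'.hasSum.mul_left (y ^ 2))).add
      (sC.hasSum.mul_left (2 * x * y))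
  have hU := quad b c
  have hL := quad 1 (-a)
  set U := b ^ 2 * A + c ^ 2 * A' + 2 * b * c * C with hUdef
  -- The homogeneous equation identifies the energy of g - a g(· - e₁) with that of b g + c g(· -
  -- e₁) translated by e₂, so it differs from U by at most δU.
  have hL' : HasSum (fun p => w p * (b * g (p - (0, 1)) + c * g (p - (0, 1) - (1, 0))) ^ 2)
      (1 ^ 2 * A + (-a) ^ 2 * A' + 2 * 1 * (-a) * C) := by
    convert hL using 3 with p
    rw [← h p]; ring
  have hLU := shift (0, 1) (fun p => (b * g p + c * g (p - (1, 0))) ^ 2) hw2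
    (fun p => sq_nonneg _) hU.summable hL'.summable
  rw [hU.tsum_eq, hL'.tsum_eq] at hLU
  -- Positivity of these sums gives |C| ≤ (A + A')/2 and U ≤ 2b²A + 2c²A'.
  have q1 := (quad 1 1).nonneg fun p => mul_nonneg (hw p).le (sq_nonneg _)
  have q2 := (quad 1 (-1)).nonneg fun p => mul_nonneg (hw p).le (sq_nonneg _)
  have q3 := (quad b (-c)).nonneg fun p => mul_nonneg (hw p).le (sq_nonneg _)
  have hA'le : A' ≤ A + δ * A := by linarith [(abs_le.1 hA'A).2]
  have hCle : |C| ≤ A + δ * A / 2 := abs_le.2 ⟨by linarith, by linarith⟩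
  have hUle : U ≤ 4 * (b ^ 2 + c ^ 2) * A := by
    have h1 : U ≤ 2 * b ^ 2 * A + 2 * c ^ 2 * A' := by rw [hUdef]; linarith
    have h2 : A' ≤ 2 * A := by nlinarith
    nlinarith [mul_le_mul_of_nonneg_left h2 (sq_nonneg c), mul_nonneg (sq_nonneg b) hA0]
  -- With a translation-invariant weight the bracket would vanish; here both of its terms are O(δ)A.
  have id1 : (1 + a ^ 2 - b ^ 2 - c ^ 2) * A = 2 * (a + b * c) * C +
      ((1 ^ 2 * A + (-a) ^ 2 * A' + 2 * 1 * (-a) * C - U) + (c ^ 2 - a ^ 2) * (A' - A)) := by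
    rw [hUdef]; ring
  have hca : |c ^ 2 - a ^ 2| ≤ a ^ 2 + c ^ 2 :=
    abs_le.2 ⟨by nlinarith [sq_nonneg a, sq_nonneg c], by nlinarith [sq_nonneg a, sq_nonneg c]⟩
  calc |1 + a ^ 2 - b ^ 2 - c ^ 2| * A = |(1 + a ^ 2 - b ^ 2 - c ^ 2) * A| := by
        rw [abs_mul, abs_of_nonneg hA0]
    _ ≤ |2 * (a + b * c) * C| + (|1 ^ 2 * A + (-a) ^ 2 * A' + 2 * 1 * (-a) * C - U| +
          |(c ^ 2 - a ^ 2) * (A' - A)|) := by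
        rw [id1]; exact (abs_add_le _ _).trans (add_le_add_right (abs_add_le _ _) _)
    _ ≤ 2 * |a + b * c| * (A + δ * A / 2) + (δ * (4 * (b ^ 2 + c ^ 2) * A) +
          (a ^ 2 + c ^ 2) * (δ * A)) := by
        rw [abs_mul, abs_mul, abs_two, abs_mul (c ^ 2 - a ^ 2)]
        gcongr
        exact hLU.trans (mul_le_mul_of_nonneg_left hUle hδ)
    _ = _ := by ring

/-- A step away from 0 multiplies the weight by (1 + δ)⁻¹, a step towards 0 by 1 + δ; either changes
it by a fraction at most δ. -/
theorem natAbs_pow_slowly_varying {δ : ℝ} (hδ : 0 ≤ δ) (n : ℤ) :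
    |((1 + δ)⁻¹) ^ (n + 1).natAbs - ((1 + δ)⁻¹) ^ n.natAbs| ≤ δ * ((1 + δ)⁻¹) ^ n.natAbs := by
  have h1 : (0 : ℝ) < 1 + δ := by linarith
  set ρ := (1 + δ)⁻¹ with hρ
  have hρ0 : 0 < ρ := inv_pos.2 h1
  have hρδ : ρ * (1 + δ) = 1 := inv_mul_cancel₀ h1.ne'
  rcases le_or_gt 0 n with hn | hn
  · have : (n + 1).natAbs = n.natAbs + 1 := by omega
    rw [this, pow_succ]
    have hp : 0 < ρ ^ n.natAbs := pow_pos hρ0 _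
    have : ρ ^ n.natAbs * ρ - ρ ^ n.natAbs = ρ ^ n.natAbs * (-(ρ * δ)) := by
      linear_combination ρ ^ n.natAbs * hρδ
    rw [this, abs_mul, abs_neg, abs_of_pos hp, abs_of_nonneg (by positivity), mul_comm]
    refine mul_le_mul_of_nonneg_right ?_ hp.le
    nlinarith
  · have : n.natAbs = (n + 1).natAbs + 1 := by omega
    rw [this, pow_succ]
    have hp : 0 < ρ ^ (n + 1).natAbs := pow_pos hρ0 _
    have : ρ ^ (n + 1).natAbs - ρ ^ (n + 1).natAbs * ρ = δ * (ρ ^ (n + 1).natAbs * ρ) := by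
      linear_combination -ρ ^ (n + 1).natAbs * hρδ
    rw [this, abs_of_nonneg (by positivity)]

theorem summable_pow_natAbs {ρ : ℝ} (h0 : 0 ≤ ρ) (h1 : ρ < 1) :
    Summable fun n : ℤ => ρ ^ n.natAbs :=
  Summable.of_nat_of_neg (by simpa using summable_geometric_of_lt_one h0 h1)
    (by simpa using summable_geometric_of_lt_one h0 h1)

theorem eq_zero_of_lag_eq_zero {a b c M : ℝ} {g : ℤ → ℤ → ℝ}
    (hΘ : 4 * (a + b * c) ^ 2 < (1 + a ^ 2 - b ^ 2 - c ^ 2) ^ 2)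
    (hg : ∀ i j, |g i j| ≤ M) (h : ∀ i j, lag a b c g i j = 0) (i j : ℤ) : g i j = 0 := by
  set s := |1 + a ^ 2 - b ^ 2 - c ^ 2| with hs
  set t := |a + b * c| with ht
  have hst : 2 * t < s := by
    refine lt_of_pow_lt_pow_left₀ 2 (abs_nonneg _) ?_
    rw [mul_pow, hs, ht, sq_abs, sq_abs]; linarith
  set K := t + 4 * (b ^ 2 + c ^ 2) + (a ^ 2 + c ^ 2) with hK
  have hK0 : 0 ≤ K := by positivity
  -- With this δ the energy estimate reads sA ≤ (2t + δK)A with 2t + δK < s, forcing A = 0. Dividing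
  -- by K + 1 allows for K = 0.
  obtain ⟨δ, hδ0, hδ1, hδK⟩ : ∃ δ : ℝ, 0 < δ ∧ δ ≤ 1 ∧ δ * K < s - 2 * t := by
    refine ⟨min 1 ((s - 2 * t) / (K + 1)), lt_min one_pos (div_pos (by linarith) (by linarith)),
      min_le_left _ _, ?_⟩
    calc _ ≤ (s - 2 * t) / (K + 1) * K := mul_le_mul_of_nonneg_right (min_le_right _ _) hK0
      _ < s - 2 * t := by
        rw [div_mul_eq_mul_div, div_lt_iff₀ (by linarith)]; nlinarith
  set ρ := (1 + δ)⁻¹ with hρ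
  have hρ0 : 0 < ρ := inv_pos.2 (by linarith)
  have hρ1 : ρ < 1 := inv_lt_one_of_one_lt₀ (by linarith)
  have hs1 := summable_pow_natAbs hρ0.le hρ1
  have hws : Summable fun p : ℤ × ℤ => ρ ^ p.1.natAbs * ρ ^ p.2.natAbs :=
    hs1.mul_of_nonneg hs1 (fun _ => by positivity) (fun _ => by positivity)
  have hw : ∀ p : ℤ × ℤ, 0 < ρ ^ p.1.natAbs * ρ ^ p.2.natAbs := fun p => by positivity
  have hE := energy_estimate (a := a) (b := b) (c := c) (g := fun p => g p.1 p.2) hδ0.le hδ1 hw hws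
    (fun p => by
      simp only [Prod.fst_add, Prod.snd_add, add_zero]
      rw [← sub_mul, abs_mul, abs_of_pos (pow_pos hρ0 p.2.natAbs), ← mul_assoc]
      exact mul_le_mul_of_nonneg_right (natAbs_pow_slowly_varying hδ0.le _) (by positivity))
    (fun p => by
      simp only [Prod.fst_add, Prod.snd_add, add_zero]
      rw [← mul_sub, abs_mul, abs_of_pos (pow_pos hρ0 p.1.natAbs), mul_left_comm]
      exact mul_le_mul_of_nonneg_left (natAbs_pow_slowly_varying hδ0.le _) (by positivity))
    (fun p => hg _ _)
    (fun p => by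
      have := h p.1 p.2
      simp only [lag] at this
      simp only [Prod.fst_sub, Prod.snd_sub, sub_zero]
      linarith)
  set A := ∑' p : ℤ × ℤ, ρ ^ p.1.natAbs * ρ ^ p.2.natAbs * g p.1 p.2 ^ 2 with hA
  have hA0 : 0 ≤ A := tsum_nonneg fun p => mul_nonneg (hw p).le (sq_nonneg _)
  have hAz : A ≤ 0 := by
    by_contra! hpos
    nlinarith
  have hsum : Summable fun p : ℤ × ℤ => ρ ^ p.1.natAbs * ρ ^ p.2.natAbs * g p.1 p.2 ^ 2 := by
    refine Summable.of_nonneg_of_le (fun p => mul_nonneg (hw p).le (sq_nonneg _)) (fun p => ?_)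
      (hws.mul_right (M ^ 2))
    refine mul_le_mul_of_nonneg_left ?_ (hw p).le
    rw [← sq_abs]
    exact pow_le_pow_left₀ (abs_nonneg _) (hg _ _) 2
  have h0 := hsum.le_tsum (i, j) fun p _ => mul_nonneg (hw p).le (sq_nonneg _)
  have hij := hw (i, j)
  have : g i j ^ 2 ≤ 0 := by
    by_contra! hpos
    have := mul_pos hij hpos
    linarith
  exact pow_eq_zero_iff two_ne_zero |>.1 (le_antisymm this (sq_nonneg _))

theorem eq_zero_of_lead_eq_zero {a b c M : ℝ} {g : ℤ → ℤ → ℝ}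
    (hΘ : 4 * (a + b * c) ^ 2 < (1 + a ^ 2 - b ^ 2 - c ^ 2) ^ 2)
    (hg : ∀ i j, |g i j| ≤ M) (h : ∀ i j, lead a b c g i j = 0) (i j : ℤ) : g i j = 0 := by
  have := eq_zero_of_lag_eq_zero (g := fun i j => g (-i) (-j)) hΘ (fun i j => hg _ _)
    (fun i j => by
      have := h (-i) (-j)
      simp only [lead, lag] at this ⊢
      have e : ∀ k : ℤ, -(k - 1) = -k + 1 := fun k => by ring
      rw [e, e]
      exact this) (-i) (-j)
  simpa using this

/-! ### Commuting operators and comparison of coefficients -/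

theorem lag_lag_comm (a b c a' b' c' : ℝ) (g : ℤ → ℤ → ℝ) :
    lag a b c (lag a' b' c' g) = lag a' b' c' (lag a b c g) := by
  funext i j; simp only [lag]; ring

theorem lead_lead_comm (a b c a' b' c' : ℝ) (g : ℤ → ℤ → ℝ) :
    lead a b c (lead a' b' c' g) = lead a' b' c' (lead a b c g) := by
  funext i j; simp only [lead]; ring

theorem lag_lead_comm (a b c a' b' c' : ℝ) (g : ℤ → ℤ → ℝ) :
    lag a b c (lead a' b' c' g) = lead a' b' c' (lag a b c g) := by
  funext i j; simp only [lag, lead, sub_add_cancel, add_sub_cancel_right]; ring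

theorem abs_lag_le {a b c M : ℝ} {g : ℤ → ℤ → ℝ} (hg : ∀ i j, |g i j| ≤ M) (i j : ℤ) :
    |lag a b c g i j| ≤ M + |a| * M + |b| * M + |c| * M := by
  have hm : ∀ x i j, |x * g i j| ≤ |x| * M := fun x i j => by
    rw [abs_mul]; exact mul_le_mul_of_nonneg_left (hg i j) (abs_nonneg x)
  refine (abs_sub _ _).trans (add_le_add ((abs_sub _ _).trans (add_le_add
    ((abs_sub _ _).trans (add_le_add (hg _ _) (hm _ _ _))) (hm _ _ _))) (hm _ _ _))

/-- The function with value `v` at the origin and `0` elsewhere. -/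
def unitMass (v : ℝ) : ℤ → ℤ → ℝ := fun i j => if i = 0 ∧ j = 0 then v else 0

/-- Bounded solutions of `lead (lag γ) = v δ₀` are unique. -/
theorem eq_of_lead_lag_eq {a b c M M' : ℝ} {g g' : ℤ → ℤ → ℝ}
    (hΘ : 4 * (a + b * c) ^ 2 < (1 + a ^ 2 - b ^ 2 - c ^ 2) ^ 2)
    (hg : ∀ i j, |g i j| ≤ M) (hg' : ∀ i j, |g' i j| ≤ M')
    (h : lead a b c (lag a b c g) = lead a b c (lag a b c g')) : g = g' := by
  have hd : ∀ i j, |g i j - g' i j| ≤ M + M' := fun i j =>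
    (abs_sub _ _).trans (add_le_add (hg i j) (hg' i j))
  have h1 : ∀ i j, lag a b c (fun i j => g i j - g' i j) i j = 0 := by
    refine eq_zero_of_lead_eq_zero hΘ (abs_lag_le hd) fun i j => ?_
    have := congrFun (congrFun h i) j
    simp only [lead, lag] at this ⊢
    linarith
  funext i j
  exact sub_eq_zero.1 (eq_zero_of_lag_eq_zero hΘ hd h1 i j)

/-- `lead ∘ lag` is convolution with a symmetric nine-point kernel, the coefficients of |P|². The
hypotheses say that its five distinct entries scale by r. -/
theorem lead_lag_scale {a b c a' b' c' r : ℝ}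
    (h0 : 1 + a' ^ 2 + b' ^ 2 + c' ^ 2 = r * (1 + a ^ 2 + b ^ 2 + c ^ 2))
    (h1 : b' * c' - a' = r * (b * c - a)) (h2 : a' * c' - b' = r * (a * c - b))
    (h3 : c' = r * c) (h4 : a' * b' = r * (a * b)) (g : ℤ → ℤ → ℝ) (i j : ℤ) :
    lead a' b' c' (lag a' b' c' g) i j = r * lead a b c (lag a b c g) i j := by
  simp only [lead, lag, add_sub_cancel_right]
  linear_combination g i j * h0 + (g (i - 1) j + g (i + 1) j) * h1 +
    (g i (j - 1) + g i (j + 1)) * h2 - (g (i - 1) (j - 1) + g (i + 1) (j + 1)) * h3 +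
    (g (i + 1) (j - 1) + g (i - 1) (j + 1)) * h4

theorem scale_of_lead_lag_eq {a b c a' b' c' v v' : ℝ} {g : ℤ → ℤ → ℝ}
    (h : lead a b c (lag a b c g) = unitMass v)
    (h' : lead a' b' c' (lag a' b' c' g) = unitMass v') :
    v * (1 + a' ^ 2 + b' ^ 2 + c' ^ 2) = v' * (1 + a ^ 2 + b ^ 2 + c ^ 2) ∧
    v * (b' * c' - a') = v' * (b * c - a) ∧ v * (a' * c' - b') = v' * (a * c - b) ∧
    v * c' = v' * c ∧ v * (a' * b') = v' * (a * b) := by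
  -- Applying both second-order operators to g in either order leaves each kernel acting on a point
  -- mass, which exposes its coefficients.
  have key : lead a' b' c' (lag a' b' c' (unitMass v)) = lead a b c (lag a b c (unitMass v')) := by
    rw [← h, ← h', lag_lead_comm, lag_lead_comm, lead_lead_comm, lag_lag_comm]
  have e := fun i j => congrFun (congrFun key i) j
  have e0 := e 0 0
  have e1 := e 1 0
  have e2 := e 0 1
  have e3 := e 1 1
  have e4 := e 1 (-1)
  norm_num [lead, lag, unitMass] at e0 e1 e2 e3 e4
  refine ⟨?_, ?_, ?_, ?_, ?_⟩ <;> linarith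

/-! ### Boundedness and the Yule–Walker equations -/

section Necessity

variable {Ω : Type*} [MeasurableSpace Ω] {μ : Measure Ω}

theorem two_mul_abs_covariance_le [IsProbabilityMeasure μ] {X Y : Ω → ℝ}
    (hX : MemLp X 2 μ) (hY : MemLp Y 2 μ) :
    2 * |covariance X Y μ| ≤ covariance X X μ + covariance Y Y μ := by
  have h1 : 0 ≤ covariance (X + Y) (X + Y) μ := by
    rw [covariance_self (hX.add hY).aemeasurable]; exact variance_nonneg _ _
  have h2 : 0 ≤ covariance (X - Y) (X - Y) μ := by
    rw [covariance_self (hX.sub hY).aemeasurable]; exact variance_nonneg _ _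
  rw [covariance_add_left hX hY (hX.add hY), covariance_add_right hX hX hY,
    covariance_add_right hY hX hY, covariance_comm Y X] at h1
  rw [covariance_sub_left hX hY (hX.sub hY), covariance_sub_right hX hX hY,
    covariance_sub_right hY hX hY, covariance_comm Y X] at h2
  have : |covariance X Y μ| ≤ (covariance X X μ + covariance Y Y μ) / 2 :=
    abs_le.2 ⟨by linarith, by linarith⟩
  linarith

theorem covariance_congr_left {X X' Y : Ω → ℝ} (h : X =ᵐ[μ] X') :
    covariance X Y μ = covariance X' Y μ := by
  unfold covariance
  rw [integral_congr_ae h]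
  refine integral_congr_ae ?_
  filter_upwards [h] with ω hω
  rw [hω]

theorem covariance_lag_left [IsProbabilityMeasure μ] {a b c : ℝ} {E X₁ X₂ X₃ X₄ Y : Ω → ℝ}
    (h₁ : MemLp X₁ 2 μ) (h₂ : MemLp X₂ 2 μ) (h₃ : MemLp X₃ 2 μ) (h₄ : MemLp X₄ 2 μ)
    (hY : MemLp Y 2 μ) (h : ∀ᵐ ω ∂μ, X₁ ω = a * X₂ ω + b * X₃ ω + c * X₄ ω + E ω) :
    covariance E Y μ = covariance X₁ Y μ - a * covariance X₂ Y μ - b * covariance X₃ Y μ -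
      c * covariance X₄ Y μ := by
  have hE : E =ᵐ[μ] X₁ - a • X₂ - b • X₃ - c • X₄ := by
    filter_upwards [h] with ω hω
    simp only [Pi.sub_apply, Pi.smul_apply, smul_eq_mul]
    linarith
  rw [covariance_congr_left hE,
    covariance_sub_left ((h₁.sub (h₂.const_smul a)).sub (h₃.const_smul b)) (h₄.const_smul c) hY,
    covariance_sub_left (h₁.sub (h₂.const_smul a)) (h₃.const_smul b) hY,
    covariance_sub_left h₁ (h₂.const_smul a) hY, covariance_smul_left, covariance_smul_left,
    covariance_smul_left]

end Necessity

theorem IsAutocovarianceOf.bounded {θ : Parameter} {γ : ℤ → ℤ → ℝ}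
    (h : IsAutocovarianceOf θ γ) (i j : ℤ) : |γ i j| ≤ γ 0 0 := by
  obtain ⟨a, b, c, v⟩ := θ
  obtain ⟨Ω, _, μ, ε, X, hμ, hε, hX, hAR⟩ := h
  have h1 := two_mul_abs_covariance_le (hX.memLp 0 0) (hX.memLp (0 - i) (0 - j))
  have h2 := hX.covariance_eq 0 0 0 0
  have h3 := hX.covariance_eq 0 0 (0 - i) (0 - j)
  rw [sub_zero] at h2
  simp only [sub_zero] at h3
  rw [hX.covariance_eq, h2, h3] at h1
  linarith

/-- The Yule–Walker equations of the planar autoregression. -/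
theorem IsAutocovarianceOf.lead_lag {a b c v : ℝ} {γ : ℤ → ℤ → ℝ}
    (h : IsAutocovarianceOf (a, b, c, v) γ) : lead a b c (lag a b c γ) = unitMass v := by
  obtain ⟨Ω, _, μ, ε, X, hμ, hε, hX, hAR⟩ := h
  have hXX : ∀ i j k l, covariance (X i j) (X k l) μ = γ (i - k) (j - l) := fun i j k l => by
    rw [← hX.covariance_eq (i - k) (j - l) i j, sub_sub_cancel, sub_sub_cancel]
  have hεX : ∀ i j k l, covariance (ε i j) (X k l) μ = lag a b c γ (i - k) (j - l) :=
    fun i j k l => by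
      rw [covariance_lag_left (hX.memLp _ _) (hX.memLp _ _) (hX.memLp _ _) (hX.memLp _ _)
        (hX.memLp _ _) (hAR i j), hXX, hXX, hXX, hXX, sub_right_comm i, sub_right_comm j, lag]
  funext i j
  -- No causality is available, so ε need not be uncorrelated with earlier X. Expanding both noise
  -- factors through the equation avoids it: one yields `lag`, the other `lead`.
  have hεε : covariance (ε 0 0) (ε i j) μ = lead a b c (lag a b c γ) i j := by
    rw [covariance_lag_left (hX.memLp _ _) (hX.memLp _ _) (hX.memLp _ _)
      (hX.memLp _ _) (hε.memLp _ _) (hAR 0 0)]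
    simp only [covariance_comm _ (ε i j), hεX, lead]
    simp only [zero_sub, sub_zero, sub_neg_eq_add]
  rw [← hεε, unitMass]
  split_ifs with hij
  · rw [hij.1, hij.2, covariance_self (hε.memLp 0 0).aemeasurable, hε.variance_eq]
  · exact hε.uncorrelated _ _ _ _ fun e => hij (by simpa [eq_comm] using e)

theorem IsAutocovarianceOf.unique {θ : Parameter} (hθ : θ ∈ Theta) {γ γ' : ℤ → ℤ → ℝ}
    (h : IsAutocovarianceOf θ γ) (h' : IsAutocovarianceOf θ γ') : γ = γ' := by
  obtain ⟨a, b, c, v⟩ := θ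
  exact eq_of_lead_lag_eq (mem_Theta_iff.1 hθ).1 h.bounded h'.bounded
    (h.lead_lag.trans h'.lead_lag.symm)

/-! ### A stationary solution on the torus -/

/-- A zero gives 1 - az = w(b + cz). Comparing moduli yields 1 + a² - b² - c² = 2(a + bc) Re z,
impossible since |Re z| ≤ 1. -/
theorem symbol_ne_zero {a b c : ℝ} (hΘ : 4 * (a + b * c) ^ 2 < (1 + a ^ 2 - b ^ 2 - c ^ 2) ^ 2)
    {z w : ℂ} (hz : ‖z‖ = 1) (hw : ‖w‖ = 1) : 1 - a * z - b * w - c * (z * w) ≠ 0 := by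
  intro h
  have h1 : 1 - a * z = w * (b + c * z) := by linear_combination h
  have h2 : Complex.normSq (1 - a * z) = Complex.normSq (b + c * z) := by
    rw [h1, map_mul, Complex.normSq_eq_norm_sq w, hw]; ring
  have h3 : z.re ^ 2 + z.im ^ 2 = 1 := by
    have := Complex.normSq_eq_norm_sq z
    rw [hz, Complex.normSq_apply] at this
    linarith
  simp only [Complex.normSq_apply, Complex.sub_re, Complex.sub_im, Complex.add_re, Complex.add_im,
    Complex.one_re, Complex.one_im, Complex.re_ofReal_mul, Complex.im_ofReal_mul,
    Complex.ofReal_re, Complex.ofReal_im] at h2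
  have h4 : 1 + a ^ 2 - b ^ 2 - c ^ 2 = 2 * (a + b * c) * z.re := by
    linear_combination h2 + (c ^ 2 - a ^ 2) * h3
  rw [h4] at hΘ
  nlinarith [mul_nonneg (sq_nonneg (a + b * c)) (sq_nonneg z.im)]

/-- The three-dimensional torus. -/
abbrev Torus : Type := UnitAddCircle × UnitAddCircle × UnitAddCircle

instance isProbabilityMeasure_unitAddCircle :
    IsProbabilityMeasure (volume : Measure UnitAddCircle) :=
  ⟨UnitAddCircle.measure_univ⟩

instance isProbabilityMeasure_torus : IsProbabilityMeasure (volume : Measure Torus) :=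
  inferInstanceAs (IsProbabilityMeasure
    ((volume : Measure UnitAddCircle).prod ((volume : Measure UnitAddCircle).prod volume)))

instance isAddLeftInvariant_torus : (volume : Measure Torus).IsAddLeftInvariant :=
  have _ : ((volume : Measure UnitAddCircle).prod
      (volume : Measure UnitAddCircle)).IsAddLeftInvariant := inferInstance
  Measure.prod.instIsAddLeftInvariant (μ := (volume : Measure UnitAddCircle))
    (ν := (volume : Measure UnitAddCircle).prod (volume : Measure UnitAddCircle))

/-- The character `(x, y, t) ↦ exp (2πi (m x + n y + k t))` of the torus. -/
noncomputable def character (m n k : ℤ) (x : Torus) : ℂ :=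
  fourier m x.1 * fourier n x.2.1 * fourier k x.2.2

@[fun_prop]
theorem continuous_character (m n k : ℤ) : Continuous (character m n k) := by
  unfold character; fun_prop

theorem norm_fourier_apply (n : ℤ) (x : UnitAddCircle) : ‖fourier n x‖ = 1 := by
  rw [fourier_apply]; exact Circle.norm_coe _

theorem conj_character (m n k : ℤ) (x : Torus) :
    (starRingEnd ℂ) (character m n k x) = character (-m) (-n) (-k) x := by
  simp only [character, map_mul, fourier_neg]

theorem character_mul (m n k m' n' k' : ℤ) (x : Torus) :
    character m n k x * character m' n' k' x = character (m + m') (n + n') (k + k') x := by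
  simp only [character, fourier_add]; ring

theorem exists_character_add_eq_neg {m n k : ℤ} (h : ¬ (m = 0 ∧ n = 0 ∧ k = 0)) :
    ∃ t : Torus, ∀ x, character m n k (x + t) = -character m n k x := by
  by_cases hm : m = 0
  · by_cases hn : n = 0
    · have hk : k ≠ 0 := fun hk => h ⟨hm, hn, hk⟩
      refine ⟨(0, 0, ((1 / 2 / k : ℝ) : UnitAddCircle)), fun x => ?_⟩
      simp only [character, Prod.fst_add, Prod.snd_add, add_zero]
      rw [fourier_add_half_inv_index hk one_pos]; ring
    · refine ⟨(0, ((1 / 2 / n : ℝ) : UnitAddCircle), 0), fun x => ?_⟩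
      simp only [character, Prod.fst_add, Prod.snd_add, add_zero]
      rw [fourier_add_half_inv_index hn one_pos]; ring
  · refine ⟨(((1 / 2 / m : ℝ) : UnitAddCircle), 0, 0), fun x => ?_⟩
    simp only [character, Prod.fst_add, Prod.snd_add, add_zero]
    rw [fourier_add_half_inv_index hm one_pos]; ring

/-- By translation invariance the integral equals its own negative. With a half-period translation
this supplies all the orthogonality of characters needed. -/
theorem integral_eq_zero_of_add_eq_neg {f : Torus → ℝ} {t : Torus}
    (h : ∀ x, f (x + t) = -f x) : ∫ x, f x = 0 := by
  have h1 := integral_add_left_eq_self (μ := (volume : Measure Torus)) f t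
  simp only [add_comm t, h, integral_neg] at h1
  linarith

/-- `Re (character m n 1 · G)`, where `G` depends on the first two coordinates only. -/
noncomputable def harmonicField (G : UnitAddCircle × UnitAddCircle → ℂ) (i j : ℤ) (x : Torus) : ℝ :=
  (character i j 1 x * G (x.1, x.2.1)).re

theorem continuous_harmonicField {G : UnitAddCircle × UnitAddCircle → ℂ} (hG : Continuous G)
    (i j : ℤ) : Continuous (harmonicField G i j) := by
  unfold harmonicField; fun_prop

theorem memLp_torus {f : Torus → ℝ} (hf : Continuous f) (p : ENNReal) :
    MemLp f p volume :=
  MemLp.mono_exponent ((BoundedContinuousFunction.mkOfCompact ⟨f, hf⟩).memLp_top) le_top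

theorem integral_harmonicField (G : UnitAddCircle × UnitAddCircle → ℂ) (i j : ℤ) :
    ∫ x, harmonicField G i j x = 0 := by
  refine integral_eq_zero_of_add_eq_neg (t := (0, 0, ((1 / 2 / (1 : ℤ) : ℝ) : UnitAddCircle)))
    fun x => ?_
  simp only [harmonicField, character, Prod.fst_add, Prod.snd_add, add_zero]
  rw [fourier_add_half_inv_index one_ne_zero one_pos, ← Complex.neg_re]
  ring_nf

theorem covariance_harmonicField {G : UnitAddCircle × UnitAddCircle → ℂ} (hG : Continuous G)
    (i j k l : ℤ) : covariance (harmonicField G i j) (harmonicField G k l) volume =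
      ∫ x : Torus, (character (i - k) (j - l) 0 x).re * (Complex.normSq (G (x.1, x.2.1)) / 2) := by
  have hc := continuous_harmonicField hG
  have hG' : Continuous fun x : Torus => G (x.1, x.2.1) := by fun_prop
  rw [covariance_eq_sub (memLp_torus (hc i j) 2) (memLp_torus (hc k l) 2),
    integral_harmonicField, zero_mul, sub_zero]
  have hre : ∀ z w : ℂ, z.re * w.re = (z * (starRingEnd ℂ) w).re / 2 + (z * w).re / 2 := by
    intro z w; simp only [Complex.mul_re, Complex.conj_re, Complex.conj_im]; ring
  have e1 : ∀ x : Torus, (harmonicField G i j * harmonicField G k l) x =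
      (character (i - k) (j - l) 0 x).re * (Complex.normSq (G (x.1, x.2.1)) / 2) +
        (character (i + k) (j + l) 2 x * G (x.1, x.2.1) ^ 2).re / 2 := by
    intro x
    rw [Pi.mul_apply, harmonicField, harmonicField, hre]
    congr 2
    · have : character i j 1 x * G (x.1, x.2.1) *
          (starRingEnd ℂ) (character k l 1 x * G (x.1, x.2.1)) =
          character (i - k) (j - l) 0 x * (Complex.normSq (G (x.1, x.2.1)) : ℂ) := by
        rw [map_mul, conj_character, ← Complex.mul_conj, sub_eq_add_neg i, sub_eq_add_neg j,
          ← add_neg_cancel (1 : ℤ), ← character_mul]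
        ring
      rw [this, Complex.re_mul_ofReal]; ring
    · have : (2 : ℤ) = 1 + 1 := rfl
      rw [this, ← character_mul]
      ring_nf
  -- The third coordinate acts as a random phase: this term has frequency 2 in it and averages to
  -- zero, while the conjugate product has frequency 0 and depends only on the lag.
  have e2 : ∫ x : Torus, (character (i + k) (j + l) 2 x * G (x.1, x.2.1) ^ 2).re / 2 = 0 := by
    refine integral_eq_zero_of_add_eq_neg (t := (0, 0, ((1 / 2 / (2 : ℤ) : ℝ) : UnitAddCircle)))
      fun x => ?_
    simp only [character, Prod.fst_add, Prod.snd_add, add_zero]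
    rw [fourier_add_half_inv_index two_ne_zero one_pos, ← neg_div, ← Complex.neg_re]
    ring_nf
  have i1 : Continuous fun x : Torus =>
      (character (i - k) (j - l) 0 x).re * (Complex.normSq (G (x.1, x.2.1)) / 2) := by
    have := Complex.continuous_normSq.comp hG'
    simp only [Function.comp_def] at this
    fun_prop
  have i2 : Continuous fun x : Torus =>
      (character (i + k) (j + l) 2 x * G (x.1, x.2.1) ^ 2).re / 2 := by fun_prop
  simp only [e1]
  rw [integral_add (memLp_one_iff_integrable.1 (memLp_torus i1 1))
    (memLp_one_iff_integrable.1 (memLp_torus i2 1)), e2, add_zero]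

theorem exists_isAutocovarianceOf {θ : Parameter} (hθ : θ ∈ Theta) :
    ∃ γ, IsAutocovarianceOf θ γ := by
  obtain ⟨a, b, c, v⟩ := θ
  obtain ⟨hΘ, hv⟩ := mem_Theta_iff.1 hθ
  -- The real part of a unit character has mean square 1/2, so s²/2 = v gives the noise variance v.
  set s : ℝ := √(2 * v) with hs
  have hss : s * s = 2 * v := Real.mul_self_sqrt (by linarith)
  -- Lowering an index by one multiplies the character by `fourier (-1)`; P is thus the multiplier
  -- of the lag operator, and the solution divides by it.
  set P : UnitAddCircle × UnitAddCircle → ℂ := fun x =>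
    1 - a * fourier (-1) x.1 - b * fourier (-1) x.2 - c * (fourier (-1) x.1 * fourier (-1) x.2)
    with hP
  have hP0 : ∀ x, P x ≠ 0 := fun x =>
    symbol_ne_zero hΘ (norm_fourier_apply _ _) (norm_fourier_apply _ _)
  have hPc : Continuous P := by fun_prop
  have hGc : Continuous fun x => (s : ℂ) / P x := continuous_const.div hPc hP0
  have hc : Continuous fun _ : UnitAddCircle × UnitAddCircle => (s : ℂ) := continuous_const
  refine ⟨fun m n => ∫ x : Torus, (character m n 0 x).re *
    (Complex.normSq ((s : ℂ) / P (x.1, x.2.1)) / 2), Torus, inferInstance, volume,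
    harmonicField fun _ => (s : ℂ), harmonicField fun x => (s : ℂ) / P x, inferInstance,
    ⟨fun i j => memLp_torus (continuous_harmonicField hc i j) 2, integral_harmonicField _, ?_, ?_⟩,
    ⟨fun i j => memLp_torus (continuous_harmonicField hGc i j) 2,
      ⟨0, integral_harmonicField _⟩, fun h₁ h₂ i j => ?_⟩, fun i j => .of_forall fun x => ?_⟩
  · intro i j
    rw [← covariance_self (continuous_harmonicField hc i j).aemeasurable,
      covariance_harmonicField hc]
    simp [character, Complex.normSq_ofReal, hss]
  · intro i j k l hne
    rw [covariance_harmonicField hc]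
    obtain ⟨t, ht⟩ := exists_character_add_eq_neg (m := i - k) (n := j - l) (k := 0)
      (fun h => hne (by rw [sub_eq_zero.1 h.1, sub_eq_zero.1 h.2.1]))
    refine integral_eq_zero_of_add_eq_neg (t := t) fun x => ?_
    rw [ht, Complex.neg_re, neg_mul]
  · rw [covariance_harmonicField hGc, sub_sub_cancel, sub_sub_cancel]
  · have hsub : ∀ m n p : ℤ, ∀ y : Torus, ∀ q r : ℤ, character (m + q) (n + r) p y =
        character m n p y * (fourier q y.1 * fourier r y.2.1) := fun m n p y q r => by
      simp only [character, fourier_add]; ring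
    have e1 := hsub i j 1 x (-1) 0
    have e2 := hsub i j 1 x 0 (-1)
    have e3 := hsub i j 1 x (-1) (-1)
    rw [fourier_zero, add_zero, ← sub_eq_add_neg] at e1 e2
    rw [← sub_eq_add_neg, ← sub_eq_add_neg] at e3
    simp only [harmonicField, e1, e2, e3, ← Complex.re_ofReal_mul, ← Complex.add_re]
    congr 1
    have := hP0 (x.1, x.2.1)
    field_simp
    simp only [hP]
    ring

/-! ### Reduction to the spectral equations -/

/-- `v⁻¹ |1 - a z - b w - c z w|²` has the same Fourier coefficients for both parameters. -/
def SameSpectrum (θ θ' : Parameter) : Prop :=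
  match θ, θ' with
  | (a, b, c, v), (a', b', c', v') =>
    v * (1 + a' ^ 2 + b' ^ 2 + c' ^ 2) = v' * (1 + a ^ 2 + b ^ 2 + c ^ 2) ∧
    v * (b' * c' - a') = v' * (b * c - a) ∧ v * (a' * c' - b') = v' * (a * c - b) ∧
    v * c' = v' * c ∧ v * (a' * b') = v' * (a * b)

theorem sameAutocovariance_iff {θ θ' : Parameter} (hθ : θ ∈ Theta) (hθ' : θ' ∈ Theta) :
    SameAutocovariance θ θ' ↔ SameSpectrum θ θ' := by
  obtain ⟨a, b, c, v⟩ := θ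
  obtain ⟨a', b', c', v'⟩ := θ'
  constructor
  · rintro ⟨γ, h, h'⟩
    exact scale_of_lead_lag_eq h.lead_lag h'.lead_lag
  · rintro ⟨h0, h1, h2, h3, h4⟩
    obtain ⟨hΘ, hv⟩ := mem_Theta_iff.1 hθ
    obtain ⟨hΘ', hv'⟩ := mem_Theta_iff.1 hθ'
    obtain ⟨γ, hγ⟩ := exists_isAutocovarianceOf hθ
    obtain ⟨γ', hγ'⟩ := exists_isAutocovarianceOf hθ'
    have : ∀ {x y : ℝ}, v * x = v' * y → x = v' / v * y := fun {x y} h => by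
      field_simp; linarith
    have hs := lead_lag_scale (this h0) (this h1) (this h2) (this h3) (this h4) γ
    have : γ = γ' := by
      refine eq_of_lead_lag_eq hΘ' hγ.bounded hγ'.bounded ?_
      rw [hγ'.lead_lag]
      funext i j
      rw [hs, hγ.lead_lag]
      simp only [unitMass, mul_ite, mul_zero, div_mul_cancel₀ _ hv.ne']
    exact ⟨γ, hγ, this ▸ hγ'⟩

theorem mem_autocovarianceClass_iff {θ θ' : Parameter} (hθ : θ ∈ Theta) :
    θ' ∈ autocovarianceClass θ ↔ θ' ∈ Theta ∧ SameSpectrum θ θ' :=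
  and_congr_right fun h => sameAutocovariance_iff hθ h

theorem sameAutocovariance_equivalence :
    Equivalence fun θ θ' : Theta => SameAutocovariance (θ : Parameter) (θ' : Parameter) where
  refl θ := (exists_isAutocovarianceOf θ.2).imp fun _ h => ⟨h, h⟩
  symm := fun ⟨γ, h, h'⟩ => ⟨γ, h', h⟩
  -- The middle parameter has only one autocovariance function, so the two witnesses coincide.
  trans := by
    rintro θ θ' θ'' ⟨γ, h, h'⟩ ⟨δ, k', k''⟩
    exact ⟨γ, h, (h'.unique θ'.2 k') ▸ k''⟩

/-! ### Solving the spectral equations -/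

/-- Classification of the solutions of the spectral equations, for a nonzero coefficient `c`. -/
theorem spectrum_cases {a b c r a' b' : ℝ} (hc : c ≠ 0) (hr : 0 < r)
    (h0 : 1 + a' ^ 2 + b' ^ 2 + (r * c) ^ 2 = r * (1 + a ^ 2 + b ^ 2 + c ^ 2))
    (h1 : b' * (r * c) - a' = r * (b * c - a)) (h2 : a' * (r * c) - b' = r * (a * c - b))
    (h4 : a' * b' = r * (a * b)) :
    (r = 1 ∧ a' = a ∧ b' = b) ∨ (r * c ^ 2 = 1 ∧ a' = -b / c ∧ b' = -a / c) ∨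
      (c = -(a * b) ∧ ((r * a ^ 2 = 1 ∧ a' = a⁻¹ ∧ b' = b) ∨
        (r * b ^ 2 = 1 ∧ a' = a ∧ b' = b⁻¹))) := by
  obtain ⟨s, hs⟩ : ∃ s, s = r * c := ⟨_, rfl⟩
  rw [← hs] at h0 h1 h2
  have hr0 := hr.ne'
  -- `h1` and `h2` are linear in (a', b') with determinant 1 - s², where s = c'. In the singular
  -- case, solvability requires (1 - r)(b + sa) = 0.
  by_cases hD : 1 - s ^ 2 = 0
  · have hs2 : s ^ 2 = 1 := by linarith
    have hbs : (1 - r) * (b + s * a) = 0 := by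
      linear_combination -s * h1 - h2 + (b' - b) * hs2 + (s * b + a) * hs
    by_cases hr1 : r = 1
    · subst hr1
      rw [one_mul] at hs
      subst hs
      have e : (b' - b) * (a + s * b') = 0 := by linear_combination h4 + b' * h1
      rcases mul_eq_zero.1 e with e | e
      · exact .inl ⟨rfl, by linear_combination s * e - h1, by linarith⟩
      · refine .inr (.inl ⟨by linarith, ?_, ?_⟩)
        · rw [eq_div_iff hc]; linear_combination -s * h1 + s * e - b * hs2
        · rw [eq_div_iff hc]; linear_combination e
    have hb := (mul_eq_zero.1 hbs).resolve_left (sub_ne_zero.2 (Ne.symm hr1))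
    obtain rfl : b = -(s * a) := by linarith
    have hd : b' - s * a' = -(s * a) * (1 + r) := by
      linear_combination s * h1 - (b' + s * a) * hs2 + s ^ 2 * a * hs
    have hra : r * a ^ 2 = 1 := by
      have : (r * a ^ 2 - 1) * (r - 1) ^ 2 = 0 := by
        linear_combination -r * (b' - s * a' + -(s * a) * (1 + r)) * hd + r * h0 -
          2 * r * s * h4 - (s + r * c) * hs + (r * a' ^ 2 - r * a ^ 2 * (1 + r) ^ 2 - r +
          3 * r ^ 2 * a ^ 2 + 1) * hs2
      linarith [(mul_eq_zero.1 this).resolve_right (pow_ne_zero 2 (sub_ne_zero.2 hr1))]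
    have hrb : r * (-(s * a)) ^ 2 = 1 := by linear_combination hra + r * a ^ 2 * hs2
    have hb0 : -(s * a) ≠ 0 := by intro h; simp [h] at hrb
    -- With b = -sa, the numbers b' and -sa' have sum (1 + r)b and product rb², so b' is b or rb.
    have e : (b' - -(s * a)) * (b' - r * -(s * a)) = 0 := by
      linear_combination b' * hd + s * h4 + hrb - hra - (r * a ^ 2) * hs2
    have hcab : c = -(a * -(s * a)) := by
      refine mul_left_cancel₀ hr0 ?_
      linear_combination -hs - s * hra
    refine .inr (.inr ⟨hcab, ?_⟩)
    rcases mul_eq_zero.1 e with e | e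
    · have hbb : b' = -(s * a) := by linarith
      refine .inl ⟨hra, eq_inv_of_mul_eq_one_left ?_, hbb⟩
      refine mul_left_cancel₀ hb0 ?_
      rw [hbb] at h4; linear_combination a * h4 - s * a * hra
    · have hbb : b' = r * -(s * a) := by linarith
      refine .inr ⟨hrb, ?_, eq_inv_of_mul_eq_one_left ?_⟩
      · refine mul_left_cancel₀ (mul_ne_zero hr0 hb0) ?_
        rw [hbb] at h4; linear_combination h4
      · rw [hbb]; linear_combination hrb
  -- Cramer's rule for a' and b'. Substituted into `h4` and `h0`, it gives `hE1` and `hE2`, whose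
  -- common factors r - 1 and 1 - rc² account for the identity and the dual solution.
  · have hA : a' * (1 - s ^ 2) = r * a * (1 - r * c ^ 2) + r * b * c * (r - 1) := by
      rw [hs] at h1 h2 ⊢; linear_combination -h1 - r * c * h2
    have hB : b' * (1 - s ^ 2) = r * b * (1 - r * c ^ 2) + r * a * c * (r - 1) := by
      rw [hs] at h1 h2 ⊢; linear_combination -h2 - r * c * h1
    have hE1 : r * (r - 1) * (1 - r * c ^ 2) * ((a + s * b) * (b + s * a)) = 0 := by
      have : (a' * (1 - s ^ 2)) * (b' * (1 - s ^ 2)) = r * (a * b) * (1 - s ^ 2) ^ 2 := by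
        linear_combination (1 - s ^ 2) ^ 2 * h4
      rw [hA, hB, hs] at this
      rw [hs]; linear_combination this
    have hE2 : (r - 1) * (1 - r * c ^ 2) *
        (r * ((a ^ 2 + b ^ 2) * (1 + s ^ 2) + 4 * (a * b) * s) - (1 - s ^ 2) ^ 2) = 0 := by
      have : (a' * (1 - s ^ 2)) ^ 2 + (b' * (1 - s ^ 2)) ^ 2 =
          (r * (1 + a ^ 2 + b ^ 2 + c ^ 2) - 1 - s ^ 2) * (1 - s ^ 2) ^ 2 := by
        linear_combination (1 - s ^ 2) ^ 2 * h0
      rw [hA, hB, hs] at this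
      rw [hs]; linear_combination this
    have hD2 : (1 - s ^ 2) ^ 2 ≠ 0 := pow_ne_zero 2 hD
    by_cases hr1 : r = 1
    · subst hr1
      rw [one_mul] at hs
      subst hs
      exact .inl ⟨rfl, mul_right_cancel₀ hD (by linear_combination hA),
        mul_right_cancel₀ hD (by linear_combination hB)⟩
    by_cases hp : 1 - r * c ^ 2 = 0
    · have hrc : r * c ^ 2 = 1 := by linarith
      refine .inr (.inl ⟨hrc, ?_, ?_⟩)
      · rw [eq_div_iff hc]
        refine mul_right_cancel₀ hD ?_
        rw [hs] at hA ⊢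
        linear_combination c * hA + (-r * a * c + b * (r - 1) - r * b) * hrc
      · rw [eq_div_iff hc]
        refine mul_right_cancel₀ hD ?_
        rw [hs] at hB ⊢
        linear_combination c * hB + (-r * b * c + a * (r - 1) - r * a) * hrc
    have hr1' : r - 1 ≠ 0 := sub_ne_zero.2 hr1
    have hE2' := (mul_eq_zero.1 hE2).resolve_left (mul_ne_zero hr1' hp)
    right; right
    rcases mul_eq_zero.1 ((mul_eq_zero.1 hE1).resolve_left
      (mul_ne_zero (mul_ne_zero hr0 hr1') hp)) with h | h
    · have ha : a = -(s * b) := by linarith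
      have hrb : r * b ^ 2 = 1 := by
        refine mul_right_cancel₀ hD2 ?_
        rw [ha] at hE2'; linear_combination hE2'
      have hcab : c = -(a * b) := by rw [ha, hs]; linear_combination -c * hrb
      have ha0 : a ≠ 0 := by rintro rfl; simp [hc] at hcab
      have haa : a' = a := by
        refine mul_right_cancel₀ hD ?_
        rw [hA]; rw [hs] at h ⊢; linear_combination (r - 1) * h
      refine ⟨hcab, .inr ⟨hrb, haa, eq_inv_of_mul_eq_one_left ?_⟩⟩
      refine mul_left_cancel₀ ha0 ?_
      rw [haa] at h4; linear_combination b * h4 + a * hrb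
    · have hb : b = -(s * a) := by linarith
      have hra : r * a ^ 2 = 1 := by
        refine mul_right_cancel₀ hD2 ?_
        rw [hb] at hE2'; linear_combination hE2'
      have hcab : c = -(a * b) := by rw [hb, hs]; linear_combination -c * hra
      have hb0 : b ≠ 0 := by rintro rfl; simp [hc] at hcab
      have hbb : b' = b := by
        refine mul_right_cancel₀ hD ?_
        rw [hB]; rw [hs] at h ⊢; linear_combination (r - 1) * h
      refine ⟨hcab, .inl ⟨hra, eq_inv_of_mul_eq_one_left ?_, hbb⟩⟩
      refine mul_left_cancel₀ hb0 ?_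
      rw [hbb] at h4; linear_combination a * h4 + b * hra

/-! ### The equivalence classes -/

/-- For c = -ab the expression defining Θ is the square of (1 - a²)(1 - b²), matching P = (1 - az)(1
- bw). -/
theorem sq_ne_one_of_mem_Theta {a b v : ℝ} (h : (a, b, -(a * b), v) ∈ Theta) :
    a ^ 2 ≠ 1 ∧ b ^ 2 ≠ 1 := by
  have h1 := (mem_Theta_iff.1 h).1
  have h2 : 0 < ((1 - a ^ 2) * (1 - b ^ 2)) ^ 2 := by linear_combination h1
  exact ⟨fun e => by simp [e] at h2, fun e => by simp [e] at h2⟩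

theorem ne_inv_of_sq_ne_one {a : ℝ} (ha : a ≠ 0) (h : a ^ 2 ≠ 1) : a ≠ a⁻¹ := fun e =>
  h (by rw [pow_two]; nth_rewrite 2 [e]; exact mul_inv_cancel₀ ha)

/-- The dual symbol is -(zw/c) P(1/z,1/w), so its modulus on the torus is |P|/|c|; the expression
defining Θ is divided by c⁴. -/
theorem dual_mem_Theta {a b c v : ℝ} (h : (a, b, c, v) ∈ Theta) (hc : c ≠ 0) :
    (-b / c, -a / c, 1 / c, v / c ^ 2) ∈ Theta := by
  obtain ⟨h1, hv⟩ := mem_Theta_iff.1 h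
  refine mem_Theta_iff.2 ⟨?_, by positivity⟩
  have e : (1 + (-b / c) ^ 2 - (-a / c) ^ 2 - (1 / c) ^ 2) ^ 2 -
      4 * (-b / c + -a / c * (1 / c)) ^ 2 =
      ((1 + a ^ 2 - b ^ 2 - c ^ 2) ^ 2 - 4 * (a + b * c) ^ 2) / c ^ 4 := by
    field_simp; ring
  have : 0 < ((1 + a ^ 2 - b ^ 2 - c ^ 2) ^ 2 - 4 * (a + b * c) ^ 2) / c ^ 4 :=
    div_pos (by linarith) (by positivity)
  linarith

theorem separable_mem_Theta {a b v : ℝ} (ha : a ^ 2 ≠ 1) (hb : b ^ 2 ≠ 1) (hv : 0 < v) :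
    (a, b, -(a * b), v) ∈ Theta := by
  refine mem_Theta_iff.2 ⟨?_, hv⟩
  have : 0 < ((1 - a ^ 2) * (1 - b ^ 2)) ^ 2 := by
    have h1 : 1 - a ^ 2 ≠ 0 := sub_ne_zero.2 ha.symm
    have h2 : 1 - b ^ 2 ≠ 0 := sub_ne_zero.2 hb.symm
    positivity
  linear_combination this

theorem inv_sq_ne_one {a : ℝ} (h : a ^ 2 ≠ 1) : a⁻¹ ^ 2 ≠ 1 := by
  rwa [inv_pow, Ne, inv_eq_one]

/-- The classes when `c ≠ 0`, before distinguishing whether `c = -ab`. -/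
theorem cases_of_mem_class {a b c v a' b' c' v' : ℝ} (h : (a, b, c, v) ∈ Theta) (hc : c ≠ 0)
    (h' : (a', b', c', v') ∈ autocovarianceClass (a, b, c, v)) :
    (a' = a ∧ b' = b ∧ c' = c ∧ v' = v) ∨
    (a' = -b / c ∧ b' = -a / c ∧ c' = 1 / c ∧ v' = v / c ^ 2) ∨
    (c = -(a * b) ∧ ((a' = a⁻¹ ∧ b' = b ∧ c' = -(a⁻¹ * b) ∧ v' = v / a ^ 2) ∨
      (a' = a ∧ b' = b⁻¹ ∧ c' = -(a * b⁻¹) ∧ v' = v / b ^ 2))) := by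
  obtain ⟨hΘ', h0, h1, h2, h3, h4⟩ := (mem_autocovarianceClass_iff h).1 h'
  have hv := (mem_Theta_iff.1 h).2
  have hv' := (mem_Theta_iff.1 hΘ').2
  obtain ⟨r, hr⟩ : ∃ r, r = v' / v := ⟨_, rfl⟩
  have hr0 : 0 < r := hr ▸ div_pos hv' hv
  obtain rfl : v' = r * v := by rw [hr, div_mul_cancel₀ _ hv.ne']
  have can : ∀ {x y : ℝ}, v * x = r * v * y → x = r * y := fun {x y} e =>
    mul_left_cancel₀ hv.ne' (by linarith)
  obtain rfl : c' = r * c := can h3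
  rcases spectrum_cases hc hr0 (can h0) (can h1) (can h2) (can h4) with
    ⟨rfl, ha, hb⟩ | ⟨e, ha, hb⟩ | ⟨hcab, ⟨e, ha, hb⟩ | ⟨e, ha, hb⟩⟩
  · exact .inl ⟨ha, hb, one_mul _, one_mul _⟩
  · refine .inr (.inl ⟨ha, hb, ?_, ?_⟩)
    · rw [eq_div_iff hc]; linarith
    · rw [eq_div_iff (pow_ne_zero 2 hc)]; linear_combination v * e
  · have ha0 : a ≠ 0 := by rintro rfl; simp at e
    refine .inr (.inr ⟨hcab, .inl ⟨ha, hb, ?_, ?_⟩⟩)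
    · rw [hcab]; field_simp; linear_combination -b * e
    · rw [eq_div_iff (pow_ne_zero 2 ha0)]; linear_combination v * e
  · have hb0 : b ≠ 0 := by rintro rfl; simp at e
    refine .inr (.inr ⟨hcab, .inr ⟨ha, hb, ?_, ?_⟩⟩)
    · rw [hcab]; field_simp; linear_combination -a * e
    · rw [eq_div_iff (pow_ne_zero 2 hb0)]; linear_combination v * e

theorem self_mem_class {θ : Parameter} (h : θ ∈ Theta) : θ ∈ autocovarianceClass θ :=
  ⟨h, sameAutocovariance_equivalence.refl ⟨θ, h⟩⟩

theorem dual_mem_class {a b c v : ℝ} (h : (a, b, c, v) ∈ Theta) (hc : c ≠ 0) :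
    (-b / c, -a / c, 1 / c, v / c ^ 2) ∈ autocovarianceClass (a, b, c, v) := by
  refine (mem_autocovarianceClass_iff h).2 ⟨dual_mem_Theta h hc, ?_, ?_, ?_, ?_, ?_⟩ <;>
    field_simp <;> ring

theorem class_generic {a b c v : ℝ} (h : (a, b, c, v) ∈ Theta) (hcab : c ≠ -(a * b))
    (hc : c ≠ 0) :
    autocovarianceClass (a, b, c, v) = {(a, b, c, v), (-b / c, -a / c, 1 / c, v / c ^ 2)} := by
  refine Set.Subset.antisymm ?_ ?_
  · rintro ⟨a', b', c', v'⟩ h'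
    rcases cases_of_mem_class h hc h' with ⟨rfl, rfl, rfl, rfl⟩ | ⟨rfl, rfl, rfl, rfl⟩ | h
    · simp
    · simp
    · exact absurd h.1 hcab
  · rintro θ' (rfl | rfl)
    · exact self_mem_class h
    · exact dual_mem_class h hc

/-- A fixed point would have c² = 1 and b = -ac, hence 1 + a² - b² - c² = 0, which Θ excludes. -/
theorem ne_dual {a b c v : ℝ} (h : (a, b, c, v) ∈ Theta) (hc : c ≠ 0) :
    (a, b, c, v) ≠ (-b / c, -a / c, 1 / c, v / c ^ 2) := by
  intro e
  simp only [Prod.mk.injEq] at e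
  obtain ⟨e1, -, e3, -⟩ := e
  have h1 := (mem_Theta_iff.1 h).1
  rw [eq_div_iff hc] at e1 e3
  obtain rfl : b = -(a * c) := by linarith
  have : (1 + a ^ 2 - (-(a * c)) ^ 2 - c ^ 2) = 0 := by linear_combination (-1 - a ^ 2) * e3
  rw [this] at h1
  nlinarith [sq_nonneg (a + -(a * c) * c)]

/-- Each factor of (1 - az)(1 - bw) can be reflected independently; the dual reflects both. -/
theorem class_separable {a b v : ℝ} (h : (a, b, -(a * b), v) ∈ Theta) (ha : a ≠ 0) (hb : b ≠ 0) :
    autocovarianceClass (a, b, -(a * b), v) =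
      {(a, b, -(a * b), v), (a⁻¹, b⁻¹, -(a⁻¹ * b⁻¹), v / (a ^ 2 * b ^ 2)),
        (a⁻¹, b, -(a⁻¹ * b), v / a ^ 2), (a, b⁻¹, -(a * b⁻¹), v / b ^ 2)} := by
  have hc : -(a * b) ≠ 0 := neg_ne_zero.2 (mul_ne_zero ha hb)
  obtain ⟨ha1, hb1⟩ := sq_ne_one_of_mem_Theta h
  have hv := (mem_Theta_iff.1 h).2
  have ed : (-b / -(a * b), -a / -(a * b), 1 / -(a * b), v / (-(a * b)) ^ 2) =
      (a⁻¹, b⁻¹, -(a⁻¹ * b⁻¹), v / (a ^ 2 * b ^ 2)) := by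
    simp only [Prod.mk.injEq]
    refine ⟨?_, ?_, ?_, ?_⟩ <;> field_simp
  refine Set.Subset.antisymm ?_ ?_
  · rintro ⟨a', b', c', v'⟩ h'
    rcases cases_of_mem_class h hc h' with
      ⟨rfl, rfl, rfl, rfl⟩ | ⟨rfl, rfl, rfl, rfl⟩ | ⟨-, ⟨rfl, rfl, rfl, rfl⟩ | ⟨rfl, rfl, rfl, rfl⟩⟩
    · simp
    · rw [ed]; simp
    · simp
    · simp
  · rintro θ' (rfl | rfl | rfl | rfl)
    · exact self_mem_class h
    · rw [← ed]; exact dual_mem_class h hc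
    · refine (mem_autocovarianceClass_iff h).2
        ⟨separable_mem_Theta (inv_sq_ne_one ha1) hb1 (by positivity), ?_, ?_, ?_, ?_, ?_⟩ <;>
      field_simp <;> ring
    · refine (mem_autocovarianceClass_iff h).2
        ⟨separable_mem_Theta ha1 (inv_sq_ne_one hb1) (by positivity), ?_, ?_, ?_, ?_, ?_⟩ <;>
      field_simp <;> ring

theorem ncard_class_separable {a b v : ℝ} (h : (a, b, -(a * b), v) ∈ Theta) (ha : a ≠ 0)
    (hb : b ≠ 0) : (autocovarianceClass (a, b, -(a * b), v)).ncard = 4 := by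
  obtain ⟨ha1, hb1⟩ := sq_ne_one_of_mem_Theta h
  have hai := ne_inv_of_sq_ne_one ha ha1
  have hbi := ne_inv_of_sq_ne_one hb hb1
  rw [class_separable h ha hb, Set.ncard_insert_of_notMem, Set.ncard_insert_of_notMem,
    Set.ncard_pair]
  · simp [hai.symm]
  · simp [hbi.symm, hai.symm]
  · simp [hai, hbi]

/-- Once c = c' = 0, the first-order equations leave only the ratio r = v'/v free. If ab ≠ 0 the
mixed coefficient forces r = 1; otherwise the last equation leaves r = 1 or r(a² + b²) = 1. -/
theorem class_of_c_eq_zero {a b v a' b' c' v' : ℝ} (h : (a, b, 0, v) ∈ Theta)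
    (h' : (a', b', c', v') ∈ autocovarianceClass (a, b, 0, v)) :
    ∃ r > 0, v' = r * v ∧ c' = 0 ∧ a' = r * a ∧ b' = r * b ∧
      r ^ 2 * (a * b) = r * (a * b) ∧ (r - 1) * (r * (a ^ 2 + b ^ 2) - 1) = 0 := by
  obtain ⟨hΘ', h0, h1, h2, h3, h4⟩ := (mem_autocovarianceClass_iff h).1 h'
  have hv := (mem_Theta_iff.1 h).2
  have hv' := (mem_Theta_iff.1 hΘ').2
  obtain ⟨r, hr⟩ : ∃ r, r = v' / v := ⟨_, rfl⟩
  obtain rfl : v' = r * v := by rw [hr, div_mul_cancel₀ _ hv.ne']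
  have can : ∀ {x y : ℝ}, v * x = r * v * y → x = r * y := fun {x y} e =>
    mul_left_cancel₀ hv.ne' (by linarith)
  obtain rfl : c' = 0 := by simpa using can h3
  have ha : a' = r * a := by linarith [can h1]
  have hb : b' = r * b := by linarith [can h2]
  have e0 := can h0
  have e4 := can h4
  rw [ha, hb] at e0 e4
  exact ⟨r, hr ▸ div_pos hv' hv, rfl, rfl, ha, hb, by linarith, by linarith⟩

theorem class_left {a v : ℝ} (h : (a, 0, 0, v) ∈ Theta) (ha : a ≠ 0) :
    autocovarianceClass (a, 0, 0, v) = {(a, 0, 0, v), (a⁻¹, 0, 0, v / a ^ 2)} := by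
  -- Viewed as separable with b = 0, the parameter inherits a² ≠ 1.
  have hsep : (a, 0, -(a * 0), v) ∈ Theta := by simpa using h
  have hv := (mem_Theta_iff.1 h).2
  refine Set.Subset.antisymm ?_ ?_
  · rintro ⟨a', b', c', v'⟩ h'
    obtain ⟨r, hr, rfl, rfl, rfl, rfl, -, e⟩ := class_of_c_eq_zero h h'
    rcases mul_eq_zero.1 e with e | e
    · obtain rfl : r = 1 := by linarith
      simp
    · right
      obtain rfl : r = 1 / a ^ 2 := by rw [eq_div_iff (pow_ne_zero 2 ha)]; linarith
      simp only [Set.mem_singleton_iff, Prod.mk.injEq, mul_zero, true_and]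
      constructor <;> field_simp
  · rintro θ' (rfl | rfl)
    · exact self_mem_class h
    · have := separable_mem_Theta (v := v / a ^ 2)
        (inv_sq_ne_one (sq_ne_one_of_mem_Theta hsep).1) (sq_ne_one_of_mem_Theta hsep).2
        (by positivity)
      rw [mul_zero, neg_zero] at this
      refine (mem_autocovarianceClass_iff h).2 ⟨this, ?_, ?_, ?_, ?_, ?_⟩ <;>
      field_simp <;> ring

theorem class_right {b v : ℝ} (h : (0, b, 0, v) ∈ Theta) (hb : b ≠ 0) :
    autocovarianceClass (0, b, 0, v) = {(0, b, 0, v), (0, b⁻¹, 0, v / b ^ 2)} := by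
  have hsep : (0, b, -(0 * b), v) ∈ Theta := by simpa using h
  have hv := (mem_Theta_iff.1 h).2
  refine Set.Subset.antisymm ?_ ?_
  · rintro ⟨a', b', c', v'⟩ h'
    obtain ⟨r, hr, rfl, rfl, rfl, rfl, -, e⟩ := class_of_c_eq_zero h h'
    rcases mul_eq_zero.1 e with e | e
    · obtain rfl : r = 1 := by linarith
      simp
    · right
      obtain rfl : r = 1 / b ^ 2 := by rw [eq_div_iff (pow_ne_zero 2 hb)]; linarith
      simp only [Set.mem_singleton_iff, Prod.mk.injEq, mul_zero, true_and]
      constructor <;> field_simp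
  · rintro θ' (rfl | rfl)
    · exact self_mem_class h
    · have := separable_mem_Theta (v := v / b ^ 2)
        (sq_ne_one_of_mem_Theta hsep).1 (inv_sq_ne_one (sq_ne_one_of_mem_Theta hsep).2)
        (by positivity)
      rw [zero_mul, neg_zero] at this
      refine (mem_autocovarianceClass_iff h).2 ⟨this, ?_, ?_, ?_, ?_, ?_⟩ <;>
      field_simp <;> ring

theorem class_singleton {a b v : ℝ} (h : (a, b, 0, v) ∈ Theta)
    (hab : a * b ≠ 0 ∨ a = 0 ∧ b = 0) :
    autocovarianceClass (a, b, 0, v) = {(a, b, 0, v)} := by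
  refine Set.Subset.antisymm ?_ (Set.singleton_subset_iff.2 (self_mem_class h))
  rintro ⟨a', b', c', v'⟩ h'
  obtain ⟨r, hr, rfl, rfl, rfl, rfl, e1, e2⟩ := class_of_c_eq_zero h h'
  obtain rfl : r = 1 := by
    rcases hab with hab | ⟨rfl, rfl⟩
    · have := mul_right_cancel₀ hab e1
      exact mul_left_cancel₀ hr.ne' (by linarith)
    · linarith
  simp

end PlanarAR

theorem mainTheorem10 :
    -- every parameter in Θ determines exactly one autocovariance function
    (∀ θ ∈ PlanarAR.Theta, ∃! γ : ℤ → ℤ → ℝ, PlanarAR.IsAutocovarianceOf θ γ) ∧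
    -- so Θ splits into classes of parameters with equal autocovariance function
    Equivalence (fun θ θ' : PlanarAR.Theta =>
      PlanarAR.SameAutocovariance (θ : PlanarAR.Parameter) (θ' : PlanarAR.Parameter)) ∧
    -- generic case
    (∀ a b c v : ℝ, (a, b, c, v) ∈ PlanarAR.Theta → c ≠ -(a * b) → c ≠ 0 →
      PlanarAR.autocovarianceClass (a, b, c, v) =
          {(a, b, c, v), (-b / c, -a / c, 1 / c, v / c ^ 2)} ∧
        (PlanarAR.autocovarianceClass (a, b, c, v)).ncard = 2) ∧
    -- symmetric case
    (∀ a b c v : ℝ, (a, b, c, v) ∈ PlanarAR.Theta → c = -(a * b) → c ≠ 0 →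
      PlanarAR.autocovarianceClass (a, b, c, v) =
          {(a, b, -(a * b), v),
           (a⁻¹, b⁻¹, -(a⁻¹ * b⁻¹), v / (a ^ 2 * b ^ 2)),
           (a⁻¹, b, -(a⁻¹ * b), v / a ^ 2),
           (a, b⁻¹, -(a * b⁻¹), v / b ^ 2)} ∧
        (PlanarAR.autocovarianceClass (a, b, c, v)).ncard = 4) ∧
    -- one nonzero coefficient, `a` or `b`
    (∀ a v : ℝ, (a, 0, 0, v) ∈ PlanarAR.Theta → a ≠ 0 →
      PlanarAR.autocovarianceClass (a, 0, 0, v) = {(a, 0, 0, v), (a⁻¹, 0, 0, v / a ^ 2)} ∧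
        (PlanarAR.autocovarianceClass (a, 0, 0, v)).ncard = 2) ∧
    (∀ b v : ℝ, (0, b, 0, v) ∈ PlanarAR.Theta → b ≠ 0 →
      PlanarAR.autocovarianceClass (0, b, 0, v) = {(0, b, 0, v), (0, b⁻¹, 0, v / b ^ 2)} ∧
        (PlanarAR.autocovarianceClass (0, b, 0, v)).ncard = 2) ∧
    -- exceptional one-element classes
    (∀ a b v : ℝ, (a, b, 0, v) ∈ PlanarAR.Theta → a * b ≠ 0 →
      PlanarAR.autocovarianceClass (a, b, 0, v) = {(a, b, 0, v)}) ∧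
    (∀ v : ℝ, (0, 0, 0, v) ∈ PlanarAR.Theta →
      PlanarAR.autocovarianceClass (0, 0, 0, v) = {(0, 0, 0, v)}) := by
  refine ⟨fun θ hθ => ?_, PlanarAR.sameAutocovariance_equivalence, fun a b c v h hcab hc => ?_,
    fun a b c v h hcab hc => ?_, fun a v h ha => ?_, fun b v h hb => ?_,
    fun a b v h hab => PlanarAR.class_singleton h (.inl hab),
    fun v h => PlanarAR.class_singleton h (.inr ⟨rfl, rfl⟩)⟩
  · obtain ⟨γ, hγ⟩ := PlanarAR.exists_isAutocovarianceOf hθ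
    exact ⟨γ, hγ, fun _ h => h.unique hθ hγ⟩
  · refine ⟨PlanarAR.class_generic h hcab hc, ?_⟩
    rw [PlanarAR.class_generic h hcab hc, Set.ncard_pair (PlanarAR.ne_dual h hc)]
  · subst hcab
    rw [neg_ne_zero, mul_ne_zero_iff] at hc
    exact ⟨PlanarAR.class_separable h hc.1 hc.2, PlanarAR.ncard_class_separable h hc.1 hc.2⟩
  · have h1 := PlanarAR.sq_ne_one_of_mem_Theta (a := a) (b := 0) (by simpa using h)
    refine ⟨PlanarAR.class_left h ha, ?_⟩
    rw [PlanarAR.class_left h ha, Set.ncard_pair]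
    simp [PlanarAR.ne_inv_of_sq_ne_one ha h1.1]
  · have h1 := PlanarAR.sq_ne_one_of_mem_Theta (a := 0) (b := b) (by simpa using h)
    refine ⟨PlanarAR.class_right h hb, ?_⟩
    rw [PlanarAR.class_right h hb, Set.ncard_pair]
    simp [PlanarAR.ne_inv_of_sq_ne_one hb h1.2]
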